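/- Model. A fog radio access network has $K_T\ge 1$ edge nodes (ENs) with $n_T\ge 1$ antennas each, $K_R\ge 1$ single-antenna users, and a library of $N\ge K_R$ files. For $\mu\ge 0$, a (serial) policy consists of the following. Each file is split into $F\ge 1$ packets. EN $i$ caches a set $\mathcal C_i$ of packets containing at most $\mu F$ packets of each file; the cache contents depend neither on the requests nor on the channels. For each request vector $d\in[N]^{K_R}$ and each sequence of channels $h_{ki}(b)\in\mathbb C^{n_T}$ ($b$ the block, $k$ the user, $i$ the EN) such that in each block the channel matrix between any set of users and any set of ENs has full rank, the policy gives: (i) a set $\mathcal F_i$ of packets of requested files that is sent to EN $i$ on its fronthaul link before the edge transmission; (ii) an edge transmission by one-shot linear precoding over $B$ blocks. In each block, a set of users is served, each with one packet of its requested file and distinct users with distinct packets. EN $i$ transmits a linear combination, with precoding vectors in $\mathbb C^{n_T}$, of the uncorrelated unit-power symbols of those served packets that lie in $\mathcal C_i\cup\mathcal F_i$, with power at most $P$. Each served user receives its own packet without interference from the other packets, with a gain that supports the rate $\log P+o(\log P)$ as $P\to\infty$ under unit-power noise. Over the $B$ blocks each user receives all $F$ packets of its file. For a fronthaul rate $r\ge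 0$ (fronthaul capacity $r\log P$), the normalized delivery time (NDT) of the policy is the supremum over all $d$ and all such channels of $\max_i \frac{|\mathcal F_i|}{Fr}+\frac BF$ (with $0/0=0$ and $a/0=\infty$ for $a>0$). Let $\bar\delta(\mu,r)$ be the infimum of the NDT over all policies, and let the minimum NDT $\delta^*(\mu,r)\in[0,\infty]$ be the lower convex envelope of $\mu\mapsto\bar\delta(\mu,r)$, i.e. the supremum of all convex functions on $[0,\infty)$ lying below it. Achievable NDT. Put $m_{\max}=\min\{K_T,\lceil K_R/n_T\rceil\}$, $u(m)=\min\{m n_T,K_R\}$, $\delta_E(m)=K_R/u(m)$, $\delta_F(m)=\frac{K_R m}{K_T r}$ and $r_{th}=\frac{n_T}{K_T}m_{\max}^2$. Let $m(r)$ be the nearest positive integer to $\sqrt{K_T r/n_T}$ (ties rounded up) if $r<r_{th}$, and $m(r)=m_{\max}$ if $r\ge r_{th}$. Let $m(\mu,r)=m(r)$ if $\mu K_T<m(r)$, $m(\mu,r)=\lfloor\mu K_T\rfloor$ if $m(r)\le\mu K_T\le m_{\max}$, and $m(\mu,r)=m_{\max}$ if $\mu K_T>m_{\max}$. Let $\delta_{ach}(\mu,r)$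 be the lower convex envelope, in $\mu\in[0,\infty)$, of $$\delta_F\big((m(\mu,r)-\lfloor\mu K_T\rfloor)^+\big)+\delta_E\big(m(\mu,r)\big).$$ Claim. For all $\mu\ge0$ and $r\ge0$, the achievable NDT is within a multiplicative factor of $3/2$ of the minimum NDT: $$\delta_{ach}(\mu,r)\le\tfrac32\,\delta^*(\mu,r).$$ -/

import Mathlib

open scoped NNReal ENNReal
open Filter Topology

noncomputable section

/-- Parameters of a fog radio access network: `KT` edge nodes (ENs) with `nT` antennas each,
`KR` single-antenna users, and a library of `N` files. -/
structure FRAN where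
  KT : ℕ
  KR : ℕ
  nT : ℕ
  N : ℕ

namespace FRAN

variable (S : FRAN)

/-- If every file is split into `F` packets, `(n, f)` stands for the `f`-th packet of file `n`. -/
abbrev Packet (F : ℕ) : Type := Fin S.N × Fin F

/-- A request vector: user `k` requests the file `d k`. -/
abbrev Demand : Type := Fin S.KR → Fin S.N

/-- The channel of one block: `H k i a` is the complex gain from antenna `a` of EN `i`
to user `k`. -/
abbrev Channel : Type := Fin S.KR → Fin S.KT → Fin S.nT → ℂ

variable {S}

/-- The linear independence assumption on the channel vectors: between any set `U` of users and
any set `T` of ENs, the channel matrix (one row per user, one column per antenna)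
has full rank. -/
def Channel.Admissible (H : S.Channel) : Prop :=
  ∀ (U : Finset (Fin S.KR)) (T : Finset (Fin S.KT)),
    (Matrix.of fun (k : U) (j : T × Fin S.nT) => H k j.1 j.2).rank = min U.card (T.card * S.nT)

variable (S)

/-- A serial delivery scheme with `F` packets per file, for given cache contents, request vector
and channels (`H b` is the channel in block `b`): an uncoded fronthaul transmission, followed by
one-shot linear precoding over `B` blocks. The coded symbols of distinct packets are
uncorrelated, with zero mean and unit power, the noise has unit power. -/
structure Delivery (F : ℕ) (cache : Fin S.KT → Finset (S.Packet F)) (d : S.Demand)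
    (H : ℕ → S.Channel) where
  /-- The set of packets sent to each EN on its fronthaul link. -/
  fronthaul : Fin S.KT → Finset (S.Packet F)
  /-- Only packets of requested files are sent on the fronthaul. -/
  fronthaul_requested : ∀ i, ∀ p ∈ fronthaul i, ∃ k, p.1 = d k
  /-- The number of blocks of the edge transmission. -/
  B : ℕ
  /-- `serve b k = some f` if user `k` is served in block `b`, with packet `f` of its
  requested file; `serve b k = none` if user `k` is not served in block `b`. -/
  serve : Fin B → Fin S.KR → Option (Fin F)
  /-- Each packet sent in a block is intended for a single user. -/
  serve_inj : ∀ b k k' f f', serve b k = some f → serve b k' = some f' →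
    (d k, f) = (d k', f') → k = k'
  /-- `precoder b P i p` is the precoding vector of EN `i` for packet `p` in block `b`, when the
  available power is `P`. -/
  precoder : Fin B → ℝ → Fin S.KT → S.Packet F → Fin S.nT → ℂ
  /-- An EN only transmits packets that are intended for a served user ... -/
  precoder_served : ∀ b P i p, precoder b P i p ≠ 0 → ∃ k f, serve b k = some f ∧ p = (d k, f)
  /-- ... and that it has in its cache or has received on the fronthaul. -/
  precoder_access : ∀ b P i p, precoder b P i p ≠ 0 → p ∈ cache i ∪ fronthaul i
  /-- The power constraint at each EN. -/
  power_le : ∀ b P i, 0 < P → ∑ p, ∑ a, ‖precoder b P i p a‖ ^ 2 ≤ P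
  /-- A served user receives no interference: the packets not intended for it are received with
  zero gain. -/
  no_interference : ∀ b P k f, 0 < P → serve b k = some f → ∀ p, p ≠ (d k, f) →
    ∑ i, ∑ a, H b k i a * precoder b P i p a = 0
  /-- The interference-free channel to a served user supports the rate `log P + o(log P)`. -/
  rate : ∀ b k f, serve b k = some f →
    Tendsto (fun P : ℝ =>
      Real.log (1 + ‖∑ i, ∑ a, H b k i a * precoder b P i (d k, f) a‖ ^ 2) / Real.log P)
      atTop (𝓝 1)
  /-- Every user receives all packets of its requested file. -/
  complete : ∀ k f, ∃ b, serve b k = some f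

variable {S}

/-- Fronthaul NDT `max_i |F_i| / (F r)`; sending packets at fronthaul rate `r = 0` takes infinite
time, and sending nothing takes no time. -/
def Delivery.fronthaulNDT {F : ℕ} {cache : Fin S.KT → Finset (S.Packet F)} {d : S.Demand}
    {H : ℕ → S.Channel} (D : S.Delivery F cache d H) (r : ℝ≥0) : ℝ≥0∞ :=
  ⨆ i, ((D.fronthaul i).card : ℝ≥0∞) / ((F : ℝ≥0∞) * (r : ℝ≥0∞))

/-- Edge NDT `B / F`. -/
def Delivery.edgeNDT {F : ℕ} {cache : Fin S.KT → Finset (S.Packet F)} {d : S.Demand}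
    {H : ℕ → S.Channel} (D : S.Delivery F cache d H) : ℝ≥0∞ :=
  (D.B : ℝ≥0∞) / (F : ℝ≥0∞)

/-- NDT of a serial delivery scheme. -/
def Delivery.ndt {F : ℕ} {cache : Fin S.KT → Finset (S.Packet F)} {d : S.Demand}
    {H : ℕ → S.Channel} (D : S.Delivery F cache d H) (r : ℝ≥0) : ℝ≥0∞ :=
  D.fronthaulNDT r + D.edgeNDT

variable (S)

/-- A policy for the fractional cache size `μ`: a number `F` of packets per file and cache
contents (chosen without knowledge of requests and channels), and a delivery scheme for every
request vector and every sequence of admissible channels. -/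
structure Policy (μ : ℝ≥0) where
  F : ℕ
  F_pos : 1 ≤ F
  cache : Fin S.KT → Finset (S.Packet F)
  cache_le : ∀ i n, (((Finset.univ.filter fun f => (n, f) ∈ cache i).card : ℕ) : ℝ≥0) / F ≤ μ
  delivery : ∀ (d : S.Demand) (H : ℕ → S.Channel), (∀ b, (H b).Admissible) →
    S.Delivery F cache d H

variable {S}

/-- NDT of a policy, for worst-case requests and channels. -/
def Policy.ndt {μ : ℝ≥0} (π : S.Policy μ) (r : ℝ≥0) : ℝ≥0∞ :=
  ⨆ (d : S.Demand) (H : ℕ → S.Channel) (hH : ∀ b, (H b).Admissible), (π.delivery d H hH).ndt r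

end FRAN

/-- Lower convex envelope on `[0, ∞)`: the supremum of all convex functions below `f`. -/
def lowerConvexEnvelope (f : ℝ≥0 → ℝ≥0∞) (x : ℝ≥0) : ℝ≥0∞ :=
  ⨆ (g : ℝ≥0 → ℝ≥0∞) (_ : ConvexOn ℝ≥0 Set.univ g) (_ : ∀ y, g y ≤ f y), g x

namespace FRAN

variable (S : FRAN)

/-- The minimal NDT over all policies (before time sharing). -/
def deltaBar (μ r : ℝ≥0) : ℝ≥0∞ := ⨅ π : S.Policy μ, π.ndt r

/-- The minimum NDT `δ*(μ, r)`: the lower convex envelope in `μ`. -/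
def deltaStar (μ r : ℝ≥0) : ℝ≥0∞ := lowerConvexEnvelope (fun x => S.deltaBar x r) μ

/-- The number of users that `m` cooperating ENs serve in a block. -/
def u (m : ℕ) : ℕ := min (m * S.nT) S.KR

/-- The largest useful multiplicity. -/
def mMax : ℕ := min S.KT ⌈(S.KR : ℝ≥0) / S.nT⌉₊

/-- The edge NDT for multiplicity `m`. -/
def deltaE (m : ℕ) : ℝ≥0∞ := (S.KR : ℝ≥0∞) / (S.u m : ℝ≥0∞)

/-- The fronthaul NDT for multiplicity `m`; it is `∞` for `r = 0 < m` and `0` for `m = 0`. -/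
def deltaF (r : ℝ≥0) (m : ℕ) : ℝ≥0∞ :=
  ((S.KR : ℝ≥0∞) * (m : ℝ≥0∞)) / ((S.KT : ℝ≥0∞) * (r : ℝ≥0∞))

/-- The nearest positive integer of `x ≥ 0`. -/
def _root_.nearestPos (x : ℝ≥0) : ℕ := max 1 ⌊x + 1 / 2⌋₊

/-- The threshold fronthaul rate. -/
def rTh : ℝ≥0 := (S.nT : ℝ≥0) / S.KT * (S.mMax : ℝ≥0) ^ 2

/-- The multiplicity `m(r)` selected without caches. -/
def mR (r : ℝ≥0) : ℕ :=
  if r < S.rTh then nearestPos (NNReal.sqrt (S.KT * r / S.nT)) else S.mMax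

/-- The multiplicity `m(μ, r)` of the scheme. -/
def mMuR (μ r : ℝ≥0) : ℕ :=
  if μ * S.KT < S.mR r then S.mR r
  else if μ * S.KT ≤ S.mMax then ⌊μ * S.KT⌋₊
  else S.mMax

/-- The achievable NDT `δ_ach(μ, r)`: the lower convex envelope in `μ` of the sum of fronthaul
and edge NDT of the scheme. The subtraction is truncated on purpose: no fronthaul transmission
takes place if the caches alone support the multiplicity `m(μ, r)`. -/
def deltaAch (μ r : ℝ≥0) : ℝ≥0∞ :=
  lowerConvexEnvelope
    (fun x => S.deltaF r (S.mMuR x r - ⌊x * S.KT⌋₊) + S.deltaE (S.mMuR x r)) μ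

end FRAN

end

/-! The converse is a count of packet copies. Let the requests be distinct, and let `m_q` be the
number of ENs that hold a requested packet `q`. Zero forcing `q` at the other served users forces
its block to serve at most `u(m_q)` users (`card_served_le_u`), so `B/F` is at least the average `E`
of `δ_E(m_q)` (`sum_inv_u_le`). Caches account for at most `μ KT` copies per packet on average and
the fronthaul must supply the rest, so with `A` the average of `m_q` the fronthaul NDT is at least
`δ_F(1) (A - μ KT)⁺`.

On the achievable side only special cache sizes matter. Rounding `√(KT r / nT)` to an integer costs
at most `3/2`: the scheme is within `3/2` of `δ_E(m)` at cache size `m / KT` (`schemeNDT_le`) and of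
`δ_E(m) + δ_F(m)` at cache size `0` (`schemeNDT_zero_le`).

A convex `g` below the scheme turns these into a bound at every `μ` (`convex_le_average`). Jensen
gives `g (A / KT) ≤ 3/2 E` and averaging gives `g 0 ≤ 3/2 (E + δ_F(1) A)`; interpolation in `μ`
reproduces exactly the converse. Hence `2/3 g` lies below every policy, and being convex it lies
below `δ*`. -/

/-! ### Full-rank matrices and Jensen's inequality -/

/-- The columns of a Cauchy matrix with at least as many rows as columns are independent. -/
theorem linearIndependent_cauchy {α β K : Type*} [Fintype α] [Fintype β] [Field K]
    {x : α → K} {y : β → K} (hx : Function.Injective x) (hy : Function.Injective y)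
    (hxy : ∀ k j, x k ≠ y j) (h : Fintype.card β ≤ Fintype.card α) :
    LinearIndependent K (fun (j : β) (k : α) => (x k - y j)⁻¹) := by
  classical
  rw [Fintype.linearIndependent_iff]
  intro v hv j₀
  -- `Q` is the numerator of `∑ j, v j / (X - y j)`: its degree is below the number of its roots `x
  -- k`, and its value at `y j₀` is a nonzero multiple of `v j₀`.
  set Q : Polynomial K := ∑ j, Polynomial.C (v j) *
    ∏ i ∈ Finset.univ.erase j, (Polynomial.X - Polynomial.C (y i)) with hQ
  have heval : ∀ z, Q.eval z = ∑ j, v j * ∏ i ∈ Finset.univ.erase j, (z - y i) := by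
    intro z
    simp [hQ, Polynomial.eval_finsetSum, Polynomial.eval_prod]
  have hQ0 : Q = 0 := by
    refine Polynomial.eq_zero_of_degree_lt_of_eval_index_eq_zero Finset.univ
      hx.injOn ?_ ?_
    · refine lt_of_lt_of_le (b := (Fintype.card β : WithBot ℕ)) ?_ (by simpa using h)
      rw [← Polynomial.mem_degreeLT]
      refine Submodule.sum_mem _ fun j _ => ?_
      rw [← Polynomial.smul_eq_C_mul]
      refine Submodule.smul_mem _ _ ?_
      rw [Polynomial.mem_degreeLT, Polynomial.degree_prod]
      simp only [Polynomial.degree_X_sub_C, Finset.sum_const, Finset.card_erase_of_mem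
        (Finset.mem_univ j), Finset.card_univ, nsmul_eq_mul, mul_one]
      have : 0 < Fintype.card β := Fintype.card_pos_iff.2 ⟨j⟩
      exact_mod_cast Nat.sub_lt this one_pos
    · intro k _
      have h0 := congrFun hv k
      simp only [Finset.sum_apply, Pi.smul_apply, smul_eq_mul, Pi.zero_apply] at h0
      rw [heval, ← mul_zero (∏ i, (x k - y i)), ← h0, Finset.mul_sum]
      refine Finset.sum_congr rfl fun j _ => ?_
      rw [← Finset.mul_prod_erase _ _ (Finset.mem_univ j)]
      have := sub_ne_zero.2 (hxy k j)
      field_simp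
  have h1 := heval (y j₀)
  rw [hQ0, Polynomial.eval_zero, Finset.sum_eq_single j₀] at h1
  · refine (mul_eq_zero.1 h1.symm).resolve_right (Finset.prod_ne_zero_iff.2 fun i hi => ?_)
    exact sub_ne_zero.2 fun h => (Finset.mem_erase.1 hi).1 (hy h).symm
  · intro j _ hj
    rw [Finset.prod_eq_zero (Finset.mem_erase.2 ⟨hj.symm, Finset.mem_univ j₀⟩) (sub_self _),
      mul_zero]
  · simp

/-- Cauchy matrices have full rank. -/
theorem rank_cauchy {α β K : Type*} [Fintype α] [Fintype β] [Field K]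
    {x : α → K} {y : β → K} (hx : Function.Injective x) (hy : Function.Injective y)
    (hxy : ∀ k j, x k ≠ y j) :
    (Matrix.of fun (k : α) (j : β) => (x k - y j)⁻¹).rank =
      min (Fintype.card α) (Fintype.card β) := by
  rcases le_total (Fintype.card β) (Fintype.card α) with h | h
  · rw [min_eq_right h, ← Matrix.rank_transpose]
    exact LinearIndependent.rank_matrix (linearIndependent_cauchy hx hy hxy h)
  · rw [min_eq_left h]
    refine LinearIndependent.rank_matrix ?_
    -- The transpose is the Cauchy matrix of the nodes `-y` and `-x`.
    have := linearIndependent_cauchy (neg_injective.comp hy) (neg_injective.comp hx)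
      (fun j k => by simpa using (hxy k j).symm) h
    simpa only [Function.comp_apply, sub_neg_eq_add, neg_add_eq_sub] using! this

theorem Matrix.eq_zero_of_mulVec_eq_zero_of_rank {m n K : Type*} [Fintype m] [Fintype n] [Field K]
    {A : Matrix m n K} (hA : A.rank = Fintype.card n) {v : n → K} (hv : A.mulVec v = 0) :
    v = 0 := by
  have h := LinearMap.finrank_range_add_finrank_ker A.mulVecLin
  rw [Module.finrank_fintype_fun_eq_card] at h
  have h0 : Module.finrank K (LinearMap.ker A.mulVecLin) = 0 := by
    have : Module.finrank K (LinearMap.range A.mulVecLin) = Fintype.card n := hA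
    omega
  have hb := Submodule.finrank_eq_zero.1 h0
  have : v ∈ LinearMap.ker A.mulVecLin := by simpa using hv
  simpa [hb] using this

/-- Jensen's inequality for averages of extended nonnegative values. -/
theorem card_mul_map_average_le {g : ℝ≥0 → ℝ≥0∞} (hg : ConvexOn ℝ≥0 Set.univ g) {ι : Type*}
    {s : Finset ι} (hs : s.Nonempty) (y : ι → ℝ≥0) :
    (s.card : ℝ≥0∞) * g ((∑ i ∈ s, y i) / s.card) ≤ ∑ i ∈ s, g (y i) := by
  induction hs using Finset.Nonempty.cons_induction with
  | singleton a => simp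
  | cons a s ha hs ih =>
    have hn : (s.card : ℝ≥0) ≠ 0 := by exact_mod_cast hs.card_pos.ne'
    rw [Finset.sum_cons, Finset.sum_cons, Finset.card_cons]
    have h1 := hg.2 (Set.mem_univ ((∑ i ∈ s, y i) / s.card)) (Set.mem_univ (y a))
      (zero_le : 0 ≤ (s.card : ℝ≥0) / (s.card + 1)) (zero_le : 0 ≤ 1 / ((s.card : ℝ≥0) + 1))
      (by field_simp)
    have h2 : ((s.card : ℝ≥0) / (s.card + 1)) • ((∑ i ∈ s, y i) / (s.card : ℝ≥0)) +
        (1 / ((s.card : ℝ≥0) + 1)) • y a = (y a + ∑ i ∈ s, y i) / ((s.card + 1 : ℕ) : ℝ≥0) := by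
      simp only [smul_eq_mul]
      push_cast
      field_simp
      ring
    rw [h2] at h1
    have h3 : ((s.card + 1 : ℕ) : ℝ≥0∞) = (((s.card : ℝ≥0) + 1 : ℝ≥0) : ℝ≥0∞) := by
      push_cast; rfl
    refine (mul_le_mul_right h1 _).trans ?_
    rw [ENNReal.smul_def, ENNReal.smul_def, smul_eq_mul, smul_eq_mul, h3, mul_add, ← mul_assoc,
      ← mul_assoc, ← ENNReal.coe_mul, ← ENNReal.coe_mul, mul_div_cancel₀ _ (by positivity),
      mul_div_cancel₀ _ (by positivity), add_comm]
    simpa using add_le_add le_rfl ih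

/-! ### Converse: zero forcing and counting of packet copies -/

namespace FRAN

variable {S : FRAN}

-- A policy's NDT is a supremum over admissible channels, so a lower bound needs one such channel. A
-- Cauchy matrix works because all its submatrices are Cauchy; negative row nodes and nonnegative
-- column nodes never meet.
variable (S) in
theorem exists_admissible : ∃ H : S.Channel, H.Admissible := by
  let y : Fin S.KT × Fin S.nT → ℂ := fun j => (finProdFinEquiv j : ℕ)
  refine ⟨fun k i a => (-((k : ℕ) + 1 : ℂ) - y (i, a))⁻¹, fun U T => ?_⟩
  have h := rank_cauchy (K := ℂ) (x := fun k : U => -((k.1 : ℕ) + 1 : ℂ))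
    (y := fun j : T × Fin S.nT => y (j.1.1, j.2)) ?_ ?_ ?_
  · simpa using h
  · intro k k' h
    have h' : ((k.1 : ℕ) : ℂ) = (k'.1 : ℕ) := by simpa using h
    exact Subtype.ext (Fin.ext (by exact_mod_cast h'))
  · intro j j' h
    have h' : finProdFinEquiv (j.1.1, j.2) = finProdFinEquiv (j'.1.1, j'.2) :=
      Fin.ext (Nat.cast_injective (R := ℂ) h)
    have h2 := Prod.ext_iff.1 (finProdFinEquiv.injective h')
    exact Prod.ext (Subtype.ext h2.1) h2.2
  · intro k j h
    have h' := congrArg Complex.re h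
    simp only [y, Complex.neg_re, Complex.add_re, Complex.natCast_re, Complex.one_re] at h'
    have h1 : (0 : ℝ) ≤ (k.1 : ℕ) := Nat.cast_nonneg _
    have h2 : (0 : ℝ) ≤ ((finProdFinEquiv (j.1.1, j.2) : Fin _) : ℕ) := Nat.cast_nonneg _
    linarith

namespace Delivery

variable {F : ℕ} {cache : Fin S.KT → Finset (S.Packet F)} {d : S.Demand} {H : ℕ → S.Channel}
  (D : S.Delivery F cache d H)

/-- The ENs that have a packet in their cache or from the fronthaul. -/
def holders (p : S.Packet F) : Finset (Fin S.KT) :=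
  Finset.univ.filter fun i => p ∈ cache i ∪ D.fronthaul i

/-- The users served in a block. -/
def served (b : Fin D.B) : Finset (Fin S.KR) :=
  Finset.univ.filter fun k => ∃ f, D.serve b k = some f

/-- With zero gain the rate ratio would be `0`, but it tends to `1`. -/
theorem exists_gain_ne_zero {b : Fin D.B} {k : Fin S.KR} {f : Fin F}
    (h : D.serve b k = some f) :
    ∃ P : ℝ, 0 < P ∧ ∑ i, ∑ a, H b k i a * D.precoder b P i (d k, f) a ≠ 0 := by
  have h1 := (D.rate b k f h).eventually_ne one_ne_zero
  obtain ⟨P, hP, hP0⟩ := (h1.and (eventually_gt_atTop 0)).exists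
  refine ⟨P, hP0, fun h0 => hP ?_⟩
  rw [h0]
  simp

/-- The joint precoding vector of the packet lies in the kernel of the channel from its holders to
the other served users. If these were at least as many as the holders' antennas, full column rank
would make the vector zero, and the packet would not reach its own user. -/
theorem card_served_le (hH : ∀ b, (H b).Admissible) (hd : Function.Injective d)
    {b : Fin D.B} {k : Fin S.KR} {f : Fin F} (h : D.serve b k = some f) :
    (D.served b).card ≤ (D.holders (d k, f)).card * S.nT := by
  classical
  by_contra! hlt
  obtain ⟨P, hP, hgain⟩ := D.exists_gain_ne_zero h
  set T := D.holders (d k, f) with hT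
  have hk : k ∈ D.served b := by simpa [served] using ⟨f, h⟩
  have hsum : ∀ k', ∑ j : T × Fin S.nT, H b k' j.1 j.2 * D.precoder b P j.1 (d k, f) j.2 =
      ∑ i, ∑ a, H b k' i a * D.precoder b P i (d k, f) a := by
    intro k'
    rw [Fintype.sum_prod_type, Finset.sum_coe_sort T
      (fun i => ∑ a, H b k' i a * D.precoder b P i (d k, f) a)]
    refine Finset.sum_subset (Finset.subset_univ T) fun i _ hi => ?_
    have : D.precoder b P i (d k, f) = 0 := by
      by_contra hne
      exact hi (by simpa [hT, holders] using D.precoder_access b P i _ hne)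
    simp [this]
  have hrank := hH b ((D.served b).erase k) T
  rw [min_eq_right (by rw [Finset.card_erase_of_mem hk]; omega)] at hrank
  have hv := Matrix.eq_zero_of_mulVec_eq_zero_of_rank (hrank.trans (by simp))
    (v := fun j : T × Fin S.nT => D.precoder b P j.1 (d k, f) j.2) <| by
      ext ⟨k', hk'⟩
      obtain ⟨hne, hk''⟩ := Finset.mem_erase.1 hk'
      obtain ⟨f', hf'⟩ : ∃ f, D.serve b k' = some f := by simpa [served] using hk''
      refine (hsum k').trans (D.no_interference b P k' f' hP hf' _ fun heq => hne ?_)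
      exact (hd (congrArg Prod.fst heq)).symm
  refine hgain ((hsum k).symm.trans (Finset.sum_eq_zero fun j _ => ?_))
  rw [show D.precoder b P j.1 (d k, f) j.2 = 0 from congrFun hv j, mul_zero]

theorem card_served_le_u (hH : ∀ b, (H b).Admissible) (hd : Function.Injective d)
    {b : Fin D.B} {k : Fin S.KR} {f : Fin F} (h : D.serve b k = some f) :
    (D.served b).card ≤ S.u (D.holders (d k, f)).card :=
  le_min (D.card_served_le hH hd h) (by simpa using Finset.card_le_univ (D.served b))

theorem one_le_card_holders (hH : ∀ b, (H b).Admissible) (hd : Function.Injective d)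
    (k : Fin S.KR) (f : Fin F) : 1 ≤ (D.holders (d k, f)).card := by
  obtain ⟨b, hb⟩ := D.complete k f
  have h := D.card_served_le hH hd hb
  have h1 : 0 < (D.served b).card :=
    Finset.card_pos.2 ⟨k, by simpa [served] using ⟨f, hb⟩⟩
  exact Nat.pos_of_mul_pos_right (h1.trans_le h)

/-- The number of blocks is at least the sum, over all requested packets, of the inverse of the
number of users that can be served along with the packet. -/
theorem sum_inv_u_le (hH : ∀ b, (H b).Admissible) (hd : Function.Injective d) :
    ∑ q : Fin S.KR × Fin F, ((S.u (D.holders (d q.1, q.2)).card : ℕ) : ℝ≥0∞)⁻¹ ≤ D.B := by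
  classical
  choose b hb using D.complete
  -- A user gets at most one packet per block, so requested packets inject into pairs of a block and
  -- a user served in it.
  have hinj : Function.Injective fun q : Fin S.KR × Fin F =>
      (⟨b q.1 q.2, q.1⟩ : Σ _ : Fin D.B, Fin S.KR) := by
    rintro ⟨k, f⟩ ⟨k', f'⟩ h
    obtain ⟨h1, h2⟩ := Sigma.mk.inj h
    obtain rfl : k = k' := eq_of_heq h2
    have h3 := hb k f
    rw [show b k f = b k f' from h1, hb k f'] at h3
    rw [Option.some.inj h3]
  calc ∑ q : Fin S.KR × Fin F, ((S.u (D.holders (d q.1, q.2)).card : ℕ) : ℝ≥0∞)⁻¹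
      ≤ ∑ q : Fin S.KR × Fin F, ((D.served (b q.1 q.2)).card : ℝ≥0∞)⁻¹ :=
        Finset.sum_le_sum fun q _ => ENNReal.inv_le_inv.2
          (by exact_mod_cast D.card_served_le_u hH hd (hb q.1 q.2))
    _ = ∑ z ∈ Finset.univ.image fun q : Fin S.KR × Fin F =>
          (⟨b q.1 q.2, q.1⟩ : Σ _ : Fin D.B, Fin S.KR), ((D.served z.1).card : ℝ≥0∞)⁻¹ := by
        rw [Finset.sum_image hinj.injOn]
    _ ≤ ∑ z ∈ Finset.univ.sigma D.served, ((D.served z.1).card : ℝ≥0∞)⁻¹ := by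
        refine Finset.sum_le_sum_of_subset fun z hz => ?_
        obtain ⟨q, -, rfl⟩ := Finset.mem_image.1 hz
        simpa [served] using ⟨q.2, hb q.1 q.2⟩
    -- Each nonempty block contributes `1`; an empty one contributes `0 * ∞ = 0`.
    _ = ∑ c, ((D.served c).card : ℝ≥0∞) * ((D.served c).card : ℝ≥0∞)⁻¹ := by
        rw [Finset.sum_sigma]
        simp
    _ ≤ ∑ _c : Fin D.B, 1 := Finset.sum_le_sum fun c _ => ENNReal.mul_inv_le_one _
    _ = D.B := by simp

/-- The packet copies held by the ENs come from the caches and from the fronthaul. -/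
theorem sum_card_holders_le (hd : Function.Injective d) {μ : ℝ≥0}
    (hμ : ∀ i n, (((Finset.univ.filter fun f => (n, f) ∈ cache i).card : ℕ) : ℝ≥0) / F ≤ μ)
    (hF : 1 ≤ F) :
    ((∑ q : Fin S.KR × Fin F, (D.holders (d q.1, q.2)).card : ℕ) : ℝ≥0) ≤
      S.KT * S.KR * (μ * F) + ∑ i, (D.fronthaul i).card := by
  classical
  have h1 : ∀ q : Fin S.KR × Fin F, (D.holders (d q.1, q.2)).card ≤
      ∑ i, ((if (d q.1, q.2) ∈ cache i then 1 else 0) +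
        (if (d q.1, q.2) ∈ D.fronthaul i then 1 else 0)) := by
    intro q
    rw [holders, Finset.card_filter]
    refine Finset.sum_le_sum fun i _ => ?_
    by_cases h : (d q.1, q.2) ∈ cache i <;> by_cases h' : (d q.1, q.2) ∈ D.fronthaul i <;>
      simp [h, h']
  have h2 : ∀ i, ∑ q : Fin S.KR × Fin F, (if (d q.1, q.2) ∈ D.fronthaul i then 1 else 0) ≤
      (D.fronthaul i).card := by
    intro i
    rw [← Finset.card_filter]
    refine Finset.card_le_card_of_injOn (fun q => (d q.1, q.2)) (fun q hq => by simpa using hq) ?_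
    rintro ⟨k, f⟩ - ⟨k', f'⟩ - h
    obtain ⟨h3, h4⟩ := Prod.mk.inj h
    exact Prod.ext (hd h3) h4
  have h3 : ∀ i, ((∑ q : Fin S.KR × Fin F, (if (d q.1, q.2) ∈ cache i then 1 else 0) : ℕ) : ℝ≥0) ≤
      S.KR * (μ * F) := by
    intro i
    rw [Fintype.sum_prod_type, Nat.cast_sum]
    refine (Finset.sum_le_sum (g := fun _ => μ * F) fun k _ => ?_).trans (by simp)
    rw [← Finset.card_filter]
    exact (div_le_iff₀ (by exact_mod_cast hF)).1 (hμ i (d k))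
  calc ((∑ q : Fin S.KR × Fin F, (D.holders (d q.1, q.2)).card : ℕ) : ℝ≥0)
      ≤ ((∑ i, (∑ q : Fin S.KR × Fin F, (if (d q.1, q.2) ∈ cache i then 1 else 0) +
          (D.fronthaul i).card) : ℕ) : ℝ≥0) := by
        refine Nat.cast_le.2 ((Finset.sum_le_sum fun q _ => h1 q).trans ?_)
        rw [Finset.sum_comm]
        refine Finset.sum_le_sum fun i _ => ?_
        rw [Finset.sum_add_distrib]
        exact add_le_add le_rfl (h2 i)
    _ ≤ ∑ i : Fin S.KT, ((S.KR : ℝ≥0) * (μ * F) + (D.fronthaul i).card) := by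
        rw [Nat.cast_sum]
        refine Finset.sum_le_sum fun i _ => ?_
        rw [Nat.cast_add]
        exact add_le_add (h3 i) le_rfl
    _ = _ := by
        rw [Finset.sum_add_distrib]
        simp [mul_assoc]

/-- The fronthaul NDT is at least the average one over the ENs. -/
theorem sum_card_fronthaul_le (hKT : 1 ≤ S.KT) (r : ℝ≥0) :
    ((∑ i, (D.fronthaul i).card : ℕ) : ℝ≥0∞) / (S.KT * (F * r)) ≤ D.fronthaulNDT r := by
  have hK0 : (S.KT : ℝ≥0∞) ≠ 0 := by exact_mod_cast (by omega : S.KT ≠ 0)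
  have h : ((∑ i, (D.fronthaul i).card : ℕ) : ℝ≥0∞) / (F * r) ≤ S.KT * D.fronthaulNDT r := by
    rw [Nat.cast_sum, div_eq_mul_inv, Finset.sum_mul]
    refine (Finset.sum_le_sum (g := fun _ => D.fronthaulNDT r) fun i _ => ?_).trans (by simp)
    rw [← div_eq_mul_inv]
    exact le_iSup (fun i => ((D.fronthaul i).card : ℝ≥0∞) / ((F : ℝ≥0∞) * (r : ℝ≥0∞))) i
  rw [div_eq_mul_inv, ENNReal.mul_inv (Or.inl hK0) (Or.inl (by simp)), mul_left_comm,
    ← div_eq_mul_inv]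
  refine (mul_le_mul_right h _).trans ?_
  rw [← mul_assoc, ENNReal.inv_mul_cancel hK0 (by simp), one_mul]

end Delivery

end FRAN

/-! ### Rounding inequalities behind the factor `3/2` -/

/-- Reducing the multiplicity below the rounded optimum `M` to `m` without fronthaul
transmissions costs at most a factor `3/2`. -/
theorem fronthaul_add_edge_le_of_lt {a X : ℝ} {m M : ℕ} (hm : 1 ≤ m) (hmM : m < M)
    (ha : (M : ℝ) - 1 < a) (hX : ((M : ℝ) - 1 / 2) ^ 2 ≤ X) :
    a / X * (M - m : ℝ) + max 1 (a / M) ≤ 3 / 2 * max 1 (a / m) := by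
  obtain ⟨n, rfl⟩ : ∃ n, M = n + 1 := ⟨M - 1, by omega⟩
  push_cast at *
  have hm' : (1 : ℝ) ≤ m := by exact_mod_cast hm
  have hn : (m : ℝ) ≤ n := by exact_mod_cast Nat.lt_succ_iff.1 hmM
  have hn0 : (0 : ℝ) < n := by linarith
  have ha' : (n : ℝ) < a := by linarith
  have ha0 : 0 < a := by linarith
  set s : ℝ := n + 1 / 2 with hs
  have hs0 : 0 < s := by positivity
  have hX' : s ^ 2 ≤ X := by convert hX using 2; rw [hs]; ring
  have h1 : a / X ≤ a / s ^ 2 := by gcongr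
  have h2 : max 1 (a / ((n : ℝ) + 1)) ≤ a / n := by
    refine max_le ((one_le_div hn0).2 ha'.le) ?_
    gcongr
    linarith
  have h3 : 3 / 2 * (a / m) - 3 / 2 * (a / n) = 3 / 2 * (a * (n - m) / (m * n)) := by
    field_simp
  have h4 : a * (n - m) / s ^ 2 ≤ a * (n - m) / (m * n) := by
    have : 0 ≤ a * (n - m) := mul_nonneg ha0.le (by linarith)
    gcongr
    nlinarith
  have h4' : 0 ≤ a * (n - m) / (m * n) := by
    have : 0 ≤ a * (n - m) := mul_nonneg ha0.le (by linarith)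
    positivity
  -- The source of `3/2`: `(n + 1/2)² ≥ 2 n`.
  have h5 : a / s ^ 2 ≤ 1 / 2 * (a / n) := by
    rw [div_mul_div_comm, one_mul]
    gcongr
    nlinarith [sq_nonneg ((n : ℝ) - 1 / 2)]
  have h6 : a / X * ((n : ℝ) + 1 - m) ≤ a / s ^ 2 * (n + 1 - m) := by
    gcongr
    linarith
  have h7 : a / s ^ 2 * ((n : ℝ) + 1 - m) = a * (n - m) / s ^ 2 + a / s ^ 2 := by ring
  have h8 : a / m ≤ max 1 (a / m) := le_max_right _ _
  linarith

/-- The rounded optimal multiplicity is optimal up to a factor `3/2` among the larger ones. -/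
theorem fronthaul_add_edge_le_of_le {a X : ℝ} {m M : ℕ} (hM : 1 ≤ M) (hmM : M ≤ m)
    (ha : 0 < a) (hX0 : 0 < X) (hX : X ≤ ((M : ℝ) + 1 / 2) ^ 2) :
    a / X * M + max 1 (a / M) ≤ 3 / 2 * (max 1 (a / m) + a / X * m) := by
  have hM' : (1 : ℝ) ≤ M := by exact_mod_cast hM
  have hmM' : (M : ℝ) ≤ m := by exact_mod_cast hmM
  have hc : 0 < a / X := by positivity
  have hcm : a / X * M ≤ a / X * m := by gcongr
  have hcM : 0 < a / X * M := by positivity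
  have h1 : (1 : ℝ) ≤ max 1 (a / m) := le_max_left _ _
  have h2 : a / m ≤ max 1 (a / m) := le_max_right _ _
  rcases max_cases (1 : ℝ) (a / M) with ⟨h, -⟩ | ⟨h, -⟩
  · rw [h]; linarith
  rw [h]
  rcases hmM.eq_or_lt with rfl | hlt
  · linarith
  have hlt' : (M : ℝ) + 1 ≤ m := by exact_mod_cast hlt
  set s : ℝ := M + 1 / 2 with hs
  have hs0 : 0 < s := by positivity
  have h3 : a / s ^ 2 ≤ a / X := by gcongr
  -- Since `3/2 m - M ≥ 0`, the largest allowed `X`, namely `s²`, is the worst case; AM-GM then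
  -- bounds the right side below by `3 a / s`.
  have h4 : a / s ^ 2 * (3 / 2 * m - M) ≤ a / X * (3 / 2 * m - M) := by
    gcongr
    linarith
  have h5 : 2 * (a / s) ≤ a / m + a / s ^ 2 * m := by
    have : a / m + a / s ^ 2 * m - 2 * (a / s) = a * (m - s) ^ 2 / (m * s ^ 2) := by
      have : (m : ℝ) ≠ 0 := by linarith
      field_simp
      ring
    have : 0 ≤ a * (m - s) ^ 2 / (m * s ^ 2) := by positivity
    linarith
  have h6 : a / M + a / s ^ 2 * M ≤ 3 * (a / s) := by
    have e : 3 * (a / s) - (a / M + a / s ^ 2 * M) = a * (3 * M * s - s ^ 2 - M ^ 2) / (M * s ^ 2) := by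
      field_simp
      ring
    have : 0 ≤ a * (3 * M * s - s ^ 2 - M ^ 2) / (M * s ^ 2) := by
      have : 0 ≤ 3 * M * s - s ^ 2 - M ^ 2 := by rw [hs]; nlinarith
      positivity
    linarith
  nlinarith

/-! ### The scheme at cache sizes `0`, `m / KT` and beyond `mMax / KT` -/

namespace FRAN

variable {S : FRAN}

theorem one_le_mMax (hKT : 1 ≤ S.KT) (hKR : 1 ≤ S.KR) (hnT : 1 ≤ S.nT) : 1 ≤ S.mMax := by
  refine le_min hKT (Nat.one_le_ceil_iff.2 ?_)
  have h1 : (0 : ℝ≥0) < S.KR := by exact_mod_cast hKR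
  have h2 : (0 : ℝ≥0) < S.nT := by exact_mod_cast hnT
  positivity

/-- The ceiling in `mMax` supplies the hypothesis `M - 1 < a` of the rounding inequality for every
`M ≤ mMax`. -/
theorem mMax_sub_one_lt :
    (S.mMax : ℝ) - 1 < (S.KR : ℝ) / S.nT := by
  have h : S.mMax ≤ ⌈(S.KR : ℝ≥0) / S.nT⌉₊ := min_le_right _ _
  have h1 : ((⌈(S.KR : ℝ≥0) / S.nT⌉₊ : ℝ≥0) : ℝ) < (((S.KR : ℝ≥0) / S.nT + 1 : ℝ≥0) : ℝ) :=
    NNReal.coe_lt_coe.2 (Nat.ceil_lt_add_one zero_le)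
  have h2 : (S.mMax : ℝ) ≤ (⌈(S.KR : ℝ≥0) / S.nT⌉₊ : ℝ) := by exact_mod_cast h
  push_cast at h1
  linarith

theorem deltaE_antitone {m m' : ℕ} (h : m ≤ m') : S.deltaE m' ≤ S.deltaE m := by
  refine ENNReal.div_le_div_left (Nat.cast_le.2 ?_) _
  exact min_le_min_right _ (Nat.mul_le_mul_right _ h)

/-- No admissible multiplicity has a smaller edge NDT than `mMax`. -/
theorem deltaE_mMax_le (hnT : 1 ≤ S.nT) {m : ℕ} (hm : m ≤ S.KT) :
    S.deltaE S.mMax ≤ S.deltaE m := by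
  rcases le_total m S.mMax with h | h
  · exact deltaE_antitone h
  refine ENNReal.div_le_div_left (Nat.cast_le.2 ?_) _
  refine le_min ?_ (min_le_right _ _)
  rcases h.eq_or_lt with h | h
  · rw [h]; exact min_le_left _ _
  refine (min_le_right _ _).trans ?_
  have h0 : (0 : ℝ≥0) < S.nT := by exact_mod_cast hnT
  -- As `mMax < m ≤ KT`, the cap `KT` is not active, so `mMax` ENs already serve all users.
  have h1 : S.mMax = ⌈(S.KR : ℝ≥0) / S.nT⌉₊ := by
    refine min_eq_right ?_
    by_contra! h'
    have h2 : S.mMax = S.KT := min_eq_left h'.le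
    omega
  have h2 : (S.KR : ℝ≥0) / S.nT ≤ S.mMax := h1 ▸ Nat.le_ceil _
  exact_mod_cast (div_le_iff₀ h0).1 h2

/-- Normal form for the rounding inequalities, with `a = KR / nT`; `deltaF_eq` is its companion with
`X = KT r / nT`. -/
theorem deltaE_eq (hKR : 1 ≤ S.KR) (hnT : 1 ≤ S.nT) {m : ℕ} (hm : 1 ≤ m) :
    S.deltaE m = ENNReal.ofReal (max 1 ((S.KR : ℝ) / S.nT / m)) := by
  have h1 : (0 : ℝ) < S.KR := by exact_mod_cast hKR
  have h2 : (0 : ℝ) < S.nT := by exact_mod_cast hnT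
  have h3 : (0 : ℝ) < m := by exact_mod_cast hm
  have hu : 0 < S.u m := lt_min (Nat.mul_pos hm hnT) hKR
  have : (0 : ℝ) < S.u m := by exact_mod_cast hu
  rw [deltaE, ← ENNReal.ofReal_natCast, ← ENNReal.ofReal_natCast, ← ENNReal.ofReal_div_of_pos this]
  congr 1
  rw [u, Nat.cast_min, Nat.cast_mul, div_div, mul_comm (S.nT : ℝ)]
  rcases le_total ((m : ℝ) * S.nT) S.KR with h | h
  · rw [min_eq_left h, max_eq_right ((one_le_div (by positivity)).2 h)]
  · rw [min_eq_right h, max_eq_left ((div_le_one (by positivity)).2 h), div_self h1.ne']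

theorem deltaF_eq (hKT : 1 ≤ S.KT) (hnT : 1 ≤ S.nT) {r : ℝ≥0} (hr : 0 < r) (m : ℕ) :
    S.deltaF r m = ENNReal.ofReal ((S.KR : ℝ) / S.nT / (S.KT * r / S.nT) * m) := by
  have h1 : (0 : ℝ) < S.KT := by exact_mod_cast hKT
  have h2 : (0 : ℝ) < S.nT := by exact_mod_cast hnT
  have h3 : (0 : ℝ) < r := hr
  rw [deltaF, ← ENNReal.ofReal_natCast, ← ENNReal.ofReal_natCast, ← ENNReal.ofReal_natCast,
    ← ENNReal.ofReal_coe_nnreal, ← ENNReal.ofReal_mul (by positivity),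
    ← ENNReal.ofReal_mul (by positivity), ← ENNReal.ofReal_div_of_pos (by positivity)]
  congr 1
  field_simp

theorem deltaF_eq_mul (r : ℝ≥0) (m : ℕ) : S.deltaF r m = S.deltaF r 1 * m := by
  simp only [deltaF, div_eq_mul_inv, Nat.cast_one, mul_one]
  ring

/-- The defining properties of the rounded multiplicity `mR r`. -/
theorem mR_spec (hKT : 1 ≤ S.KT) (hKR : 1 ≤ S.KR) (hnT : 1 ≤ S.nT) (r : ℝ≥0) :
    1 ≤ S.mR r ∧ S.mR r ≤ S.mMax ∧
      (S.mR r = 1 ∨ ((S.mR r : ℝ) - 1 / 2) ^ 2 ≤ S.KT * r / S.nT) ∧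
      (S.mR r = S.mMax ∨ (S.KT * r / S.nT : ℝ) ≤ ((S.mR r : ℝ) + 1 / 2) ^ 2) := by
  have h1 := one_le_mMax hKT hKR hnT
  have hKT0 : (0 : ℝ≥0) < S.KT := by exact_mod_cast hKT
  have hnT0 : (0 : ℝ≥0) < S.nT := by exact_mod_cast hnT
  have hX : ((NNReal.sqrt (S.KT * r / S.nT) : ℝ≥0) : ℝ) ^ 2 = S.KT * r / S.nT := by
    have := congrArg NNReal.toReal (NNReal.sq_sqrt (S.KT * r / S.nT : ℝ≥0))
    push_cast at this ⊢
    exact this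
  set x := NNReal.sqrt (S.KT * r / S.nT) with hx
  -- The threshold is where the unrounded optimum `x` reaches `mMax`.
  have hlt : r < S.rTh ↔ x < S.mMax := by
    rw [← not_le (a := (S.mMax : ℝ≥0)), hx, NNReal.le_sqrt_iff_sq_le, not_le, rTh, div_lt_iff₀ hnT0, div_mul_eq_mul_div, lt_div_iff₀ hKT0,
      mul_comm r, mul_comm (S.nT : ℝ≥0)]
  by_cases h : r < S.rTh
  · rw [mR, if_pos h]
    have hxm := hlt.1 h
    have hfl : ⌊x + 1 / 2⌋₊ ≤ S.mMax := by
      refine Nat.lt_succ_iff.1 ((Nat.floor_lt zero_le).2 ?_)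
      rw [← NNReal.coe_lt_coe] at hxm ⊢
      push_cast at hxm ⊢
      linarith
    refine ⟨le_max_left _ _, max_le h1 hfl, ?_, Or.inr ?_⟩
    · rcases le_total ⌊x + 1 / 2⌋₊ 1 with h2 | h2
      · exact Or.inl (max_eq_left h2)
      · right
        rw [nearestPos, max_eq_right h2, ← hX]
        have h3 : ((⌊x + 1 / 2⌋₊ : ℝ≥0) : ℝ) ≤ (x + 1 / 2 : ℝ≥0) :=
          NNReal.coe_le_coe.2 (Nat.floor_le zero_le)
        have h4 : (1 : ℝ) ≤ ⌊x + 1 / 2⌋₊ := by exact_mod_cast h2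
        push_cast at h3
        exact pow_le_pow_left₀ (by linarith) (by linarith) 2
    · rw [← hX, ← hx]
      have h3 : ((x + 1 / 2 : ℝ≥0) : ℝ) < ((⌊x + 1 / 2⌋₊ + 1 : ℝ≥0) : ℝ) :=
        NNReal.coe_lt_coe.2 (Nat.lt_floor_add_one _)
      have h4 : ((⌊x + 1 / 2⌋₊ : ℕ) : ℝ) ≤ (nearestPos x : ℕ) :=
        Nat.cast_le.2 (le_max_right _ _)
      push_cast at h3
      exact pow_le_pow_left₀ (NNReal.coe_nonneg x) (by linarith) 2
  · rw [mR, if_neg h]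
    refine ⟨h1, le_rfl, Or.inr ?_, Or.inl rfl⟩
    have hxm : ((S.mMax : ℝ≥0) : ℝ) ≤ x := NNReal.coe_le_coe.2 (not_lt.1 (hlt.not.1 h))
    have h4 : (1 : ℝ) ≤ S.mMax := by exact_mod_cast h1
    push_cast at hxm
    rw [← hX]
    exact pow_le_pow_left₀ (by linarith) (by linarith) 2

theorem mR_zero (hKT : 1 ≤ S.KT) (hKR : 1 ≤ S.KR) (hnT : 1 ≤ S.nT) : S.mR 0 = 1 := by
  rcases (mR_spec hKT hKR hnT 0) with ⟨h1, -, h | h, -⟩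
  · exact h
  · have : (1 : ℝ) ≤ S.mR 0 := by exact_mod_cast h1
    simp only [NNReal.coe_zero, mul_zero, zero_div] at h
    nlinarith

/-- The NDT of the scheme for the fractional cache size `x`, before memory sharing. -/
noncomputable def schemeNDT (S : FRAN) (r x : ℝ≥0) : ℝ≥0∞ :=
  S.deltaF r (S.mMuR x r - ⌊x * S.KT⌋₊) + S.deltaE (S.mMuR x r)

theorem natCast_div_mul_KT (hKT : 1 ≤ S.KT) (m : ℕ) :
    (m / S.KT : ℝ≥0) * S.KT = m := by
  have hKT0 : (S.KT : ℝ≥0) ≠ 0 := by exact_mod_cast (by omega : S.KT ≠ 0)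
  field_simp

theorem deltaF_zero (r : ℝ≥0) : S.deltaF r 0 = 0 := by simp [deltaF]

/-- The scheme without fronthaul transmissions is within `3/2` of the edge NDT. -/
theorem schemeNDT_le (hKT : 1 ≤ S.KT) (hKR : 1 ≤ S.KR) (hnT : 1 ≤ S.nT) (r : ℝ≥0) {m : ℕ}
    (hm : 1 ≤ m) (hmK : m ≤ S.KT) :
    S.schemeNDT r (m / S.KT) ≤ 3 / 2 * S.deltaE m := by
  have h32 : ∀ z : ℝ≥0∞, z ≤ 3 / 2 * z := fun z =>
    le_mul_of_one_le_left' (by rw [ENNReal.le_div_iff_mul_le] <;> norm_num)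
  obtain ⟨h1, h2, h3, h4⟩ := mR_spec hKT hKR hnT r
  rw [schemeNDT, mMuR, natCast_div_mul_KT hKT, Nat.floor_natCast]
  simp only [Nat.cast_lt, Nat.cast_le]
  split_ifs with hlt hle
  · have hr : 0 < r := by
      rw [pos_iff_ne_zero]
      rintro rfl
      rw [mR_zero hKT hKR hnT] at hlt
      omega
    have hX := h3.resolve_left (by omega)
    have ha := mMax_sub_one_lt (S := S)
    have h2' : (S.mR r : ℝ) ≤ S.mMax := by exact_mod_cast h2
    have h := fronthaul_add_edge_le_of_lt (a := (S.KR : ℝ) / S.nT) hm hlt (by linarith) hX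
    rw [deltaF_eq hKT hnT hr, deltaE_eq hKR hnT h1, deltaE_eq hKR hnT hm,
      ← ENNReal.ofReal_add (by positivity) (by positivity), Nat.cast_sub hlt.le,
      show (3 / 2 : ℝ≥0∞) = ENNReal.ofReal (3 / 2) by
        rw [ENNReal.ofReal_div_of_pos (by norm_num)]; simp,
      ← ENNReal.ofReal_mul (by norm_num)]
    exact ENNReal.ofReal_le_ofReal h
  · rw [Nat.sub_self, deltaF_zero, zero_add]
    exact h32 _
  · rw [Nat.sub_eq_zero_of_le (not_le.1 hle).le, deltaF_zero, zero_add]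
    exact (deltaE_mMax_le hnT hmK).trans (h32 _)

/-- Without caches, the scheme is within `3/2` of every multiplicity. -/
theorem schemeNDT_zero_le (hKT : 1 ≤ S.KT) (hKR : 1 ≤ S.KR) (hnT : 1 ≤ S.nT) (r : ℝ≥0) {m : ℕ}
    (hm : 1 ≤ m) (hmK : m ≤ S.KT) :
    S.schemeNDT r 0 ≤ 3 / 2 * (S.deltaE m + S.deltaF r m) := by
  obtain ⟨h1, h2, h3, h4⟩ := mR_spec hKT hKR hnT r
  have hs : S.schemeNDT r 0 = S.deltaF r (S.mR r) + S.deltaE (S.mR r) := by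
    have : (0 : ℝ≥0) < S.mR r := by exact_mod_cast h1
    rw [schemeNDT, mMuR, zero_mul, if_pos this, Nat.floor_zero, Nat.sub_zero]
  have hE32 : (3 / 2 : ℝ≥0∞) = ENNReal.ofReal (3 / 2) := by
    rw [ENNReal.ofReal_div_of_pos (by norm_num)]; simp
  rcases eq_zero_or_pos r with rfl | hr
  · have : S.deltaF 0 m = ⊤ := by
      rw [deltaF, ENNReal.coe_zero, mul_zero, ENNReal.div_zero]
      exact_mod_cast (Nat.mul_pos hKR hm).ne'
    rw [this, add_top, ENNReal.mul_top (by simp)]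
    exact le_top
  have ha := mMax_sub_one_lt (S := S)
  have hKT0 : (0 : ℝ) < S.KT := by exact_mod_cast hKT
  have hKR0 : (0 : ℝ) < S.KR := by exact_mod_cast hKR
  have hnT0 : (0 : ℝ) < S.nT := by exact_mod_cast hnT
  have hr0 : (0 : ℝ) < r := hr
  have key : S.deltaE (S.mR r) ≤ S.deltaE m → S.mR r ≤ m →
      S.schemeNDT r 0 ≤ 3 / 2 * (S.deltaE m + S.deltaF r m) := by
    intro hE hle
    rw [hs, add_comm, deltaF_eq_mul, deltaF_eq_mul r m]
    refine (add_le_add hE (mul_le_mul_right (Nat.cast_le.2 hle) _)).trans ?_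
    exact le_mul_of_one_le_left' (by rw [ENNReal.le_div_iff_mul_le] <;> norm_num)
  rcases lt_or_ge m (S.mR r) with hlt | hle
  · have hX := h3.resolve_left (by omega)
    have h2' : (S.mR r : ℝ) ≤ S.mMax := by exact_mod_cast h2
    have h := fronthaul_add_edge_le_of_lt (a := (S.KR : ℝ) / S.nT) hm hlt (by linarith) hX
    rw [hs, deltaF_eq hKT hnT hr, deltaF_eq hKT hnT hr, deltaE_eq hKR hnT h1,
      deltaE_eq hKR hnT hm,
      ← ENNReal.ofReal_add (by positivity) (by positivity),
      ← ENNReal.ofReal_add (by positivity) (by positivity), hE32,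
      ← ENNReal.ofReal_mul (by norm_num)]
    refine ENNReal.ofReal_le_ofReal ?_
    have : 0 ≤ (S.KR : ℝ) / S.nT / (S.KT * r / S.nT) * m := by positivity
    linarith
  · rcases h4 with h4 | h4
    -- At the cap there is no upper bound on `X`, but `mMax` already minimizes the edge NDT and `m`
    -- uses no less fronthaul.
    · exact key (h4 ▸ deltaE_mMax_le hnT hmK) hle
    · have h := fronthaul_add_edge_le_of_le (a := (S.KR : ℝ) / S.nT) h1 hle (by positivity)
        (by positivity) h4
      rw [hs, deltaF_eq hKT hnT hr, deltaF_eq hKT hnT hr, deltaE_eq hKR hnT h1,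
        deltaE_eq hKR hnT hm,
        ← ENNReal.ofReal_add (by positivity) (by positivity),
        ← ENNReal.ofReal_add (by positivity) (by positivity), hE32,
        ← ENNReal.ofReal_mul (by norm_num)]
      exact ENNReal.ofReal_le_ofReal h

/-- Large caches need no fronthaul transmissions. -/
theorem schemeNDT_of_mMax_lt (hKT : 1 ≤ S.KT) (hKR : 1 ≤ S.KR) (hnT : 1 ≤ S.nT) (r : ℝ≥0)
    {x : ℝ≥0} (hx : S.mMax < x * S.KT) : S.schemeNDT r x = S.deltaE S.mMax := by
  have h2 : (S.mR r : ℝ≥0) ≤ S.mMax := by exact_mod_cast (mR_spec hKT hKR hnT r).2.1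
  rw [schemeNDT, mMuR, if_neg (not_lt.2 (h2.trans hx.le)), if_neg (not_le.2 hx),
    Nat.sub_eq_zero_of_le (Nat.le_floor hx.le), deltaF_zero, zero_add]

end FRAN

/-! ### Convexity and conclusion -/

namespace FRAN

variable {S : FRAN}

/-- A convex function below the NDT of the scheme is at most `3/2` times the edge NDT of any
distribution of the multiplicities plus the fronthaul NDT that they require. -/
theorem convex_le_average (hKT : 1 ≤ S.KT) (hKR : 1 ≤ S.KR) (hnT : 1 ≤ S.nT) (r : ℝ≥0)
    {g : ℝ≥0 → ℝ≥0∞} (hg : ConvexOn ℝ≥0 Set.univ g) (hgs : ∀ x, g x ≤ S.schemeNDT r x)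
    {ι : Type*} {s : Finset ι} (hs : s.Nonempty) {m : ι → ℕ} (hm : ∀ i ∈ s, 1 ≤ m i)
    (hmK : ∀ i ∈ s, m i ≤ S.KT) (μ : ℝ≥0) :
    g μ ≤ 3 / 2 * ((∑ i ∈ s, S.deltaE (m i)) / s.card +
      S.deltaF r 1 * (((∑ i ∈ s, m i : ℕ) : ℝ≥0) / s.card - μ * S.KT : ℝ≥0)) := by
  have hn : (s.card : ℝ≥0∞) ≠ 0 := by exact_mod_cast hs.card_pos.ne'
  have hn' : (0 : ℝ≥0) < s.card := by exact_mod_cast hs.card_pos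
  have hK : (0 : ℝ≥0) < S.KT := by exact_mod_cast hKT
  set E : ℝ≥0∞ := (∑ i ∈ s, S.deltaE (m i)) / s.card with hE
  set c := S.deltaF r 1 with hc
  set A : ℝ≥0 := ((∑ i ∈ s, m i : ℕ) : ℝ≥0) / s.card with hA
  set x : ℝ≥0 := A / S.KT with hx
  have havg : ∀ z : ℝ≥0∞, (∀ i ∈ s, z ≤ S.deltaE (m i)) → z ≤ E := by
    intro z hz
    rw [hE, ENNReal.le_div_iff_mul_le (Or.inl hn) (Or.inl (by simp)), mul_comm, ← nsmul_eq_mul]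
    exact Finset.card_nsmul_le_sum s _ z hz
  have hgx : g x ≤ 3 / 2 * E := by
    have h1 := card_mul_map_average_le hg hs fun i => (m i : ℝ≥0) / S.KT
    have h2 : (∑ i ∈ s, (m i : ℝ≥0) / S.KT) / s.card = x := by
      rw [← Finset.sum_div, hx, hA, Nat.cast_sum, div_right_comm]
    rw [h2] at h1
    rw [hE, ← mul_div_assoc, ENNReal.le_div_iff_mul_le (Or.inl hn) (Or.inl (by simp)), mul_comm,
      Finset.mul_sum]
    exact h1.trans (Finset.sum_le_sum fun i hi =>
      (hgs _).trans (schemeNDT_le hKT hKR hnT r (hm i hi) (hmK i hi)))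
  have hg0 : g 0 ≤ 3 / 2 * (E + c * A) := by
    have h1 : (s.card : ℝ≥0∞) * g 0 ≤
        ∑ i ∈ s, 3 / 2 * (S.deltaE (m i) + c * m i) := by
      rw [← nsmul_eq_mul]
      refine Finset.card_nsmul_le_sum s _ _ fun i hi => (hgs _).trans ?_
      rw [hc, ← deltaF_eq_mul]
      exact schemeNDT_zero_le hKT hKR hnT r (hm i hi) (hmK i hi)
    rw [← Finset.mul_sum, Finset.sum_add_distrib, ← Finset.mul_sum] at h1
    have h2 : E + c * A = (∑ i ∈ s, S.deltaE (m i) + c * ∑ i ∈ s, (m i : ℝ≥0∞)) / s.card := by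
      rw [ENNReal.add_div, hE, hA, ENNReal.coe_div hn'.ne', mul_div_assoc]
      push_cast
      rfl
    rwa [h2, ← mul_div_assoc, ENNReal.le_div_iff_mul_le (Or.inl hn) (Or.inl (by simp)), mul_comm]
  have hApos : 0 < A := by
    refine div_pos (Nat.cast_pos.2 (Finset.sum_pos (fun i hi => hm i hi) hs)) hn'
  have hxpos : 0 < x := div_pos hApos hK
  rcases le_total μ x with h | h
  -- Memory sharing between `0` and `x`: the weight `1 - μ / x` turns the fronthaul cost of `A`
  -- copies into that of `A - μ KT`.
  · have h1 : μ / x ≤ 1 := (div_le_one hxpos).2 h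
    have h2 := hg.2 (Set.mem_univ x) (Set.mem_univ 0) (zero_le : 0 ≤ μ / x)
      (zero_le : 0 ≤ 1 - μ / x) (add_tsub_cancel_of_le h1)
    rw [smul_zero, add_zero, smul_eq_mul, div_mul_cancel₀ _ hxpos.ne', ENNReal.smul_def,
      ENNReal.smul_def, smul_eq_mul, smul_eq_mul] at h2
    have h3 : A - μ * S.KT = (1 - μ / x) * A := by
      rw [tsub_mul, one_mul, hx]
      congr 1
      field_simp
    refine h2.trans ((add_le_add (mul_le_mul_right hgx _) (mul_le_mul_right hg0 _)).trans_eq ?_)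
    rw [h3, ENNReal.coe_mul]
    have h4 : ((μ / x : ℝ≥0) : ℝ≥0∞) + ((1 - μ / x : ℝ≥0) : ℝ≥0∞) = 1 := by
      rw [← ENNReal.coe_add, add_tsub_cancel_of_le h1, ENNReal.coe_one]
    calc _ = 3 / 2 * ((((μ / x : ℝ≥0) : ℝ≥0∞) + ((1 - μ / x : ℝ≥0) : ℝ≥0∞)) * E +
          c * (((1 - μ / x : ℝ≥0) : ℝ≥0∞) * A)) := by ring
      _ = _ := by rw [h4, one_mul]
  · refine le_trans ?_ (mul_le_mul_right le_self_add _)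
    -- Any point beyond both `μ` and `mMax / KT` serves; there the scheme attains the least edge
    -- NDT, so `g` is at most `3/2 E` at both ends of a segment containing `μ`.
    set T : ℝ≥0 := μ + (S.mMax + 1) / S.KT with hT
    have hgT : g T ≤ 3 / 2 * E := by
      refine (hgs T).trans ?_
      rw [schemeNDT_of_mMax_lt hKT hKR hnT r]
      · refine (havg _ fun i hi => deltaE_mMax_le hnT (hmK i hi)).trans ?_
        exact le_mul_of_one_le_left' (by rw [ENNReal.le_div_iff_mul_le] <;> norm_num)
      · rw [hT, add_mul, div_mul_cancel₀ _ hK.ne']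
        exact (lt_add_one _).trans_le le_add_self
    have hlt : μ < T := lt_add_of_pos_right _ (by positivity)
    have hseg : μ ∈ segment ℝ≥0 x T := by
      obtain ⟨p, hp⟩ := exists_add_of_le h
      obtain ⟨q, hq⟩ := exists_add_of_le hlt.le
      have hq0 : 0 < q := by
        by_contra hq0
        rw [hq, nonpos_iff_eq_zero.1 (not_lt.1 hq0), add_zero] at hlt
        exact lt_irrefl _ hlt
      have hpq : p + q ≠ 0 := (add_pos_of_nonneg_of_pos zero_le hq0).ne'
      refine ⟨q / (p + q), p / (p + q), zero_le, zero_le, ?_, ?_⟩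
      · rw [← add_div, add_comm, div_self hpq]
      · rw [smul_eq_mul, smul_eq_mul, hq, hp]
        field_simp
        ring
    exact (hg.le_on_segment (Set.mem_univ _) (Set.mem_univ _) hseg).trans (max_le hgx hgT)

theorem convex_le_ndt (hKT : 1 ≤ S.KT) (hKR : 1 ≤ S.KR) (hnT : 1 ≤ S.nT) (hN : S.KR ≤ S.N)
    {μ r : ℝ≥0} {g : ℝ≥0 → ℝ≥0∞} (hg : ConvexOn ℝ≥0 Set.univ g)
    (hgs : ∀ x, g x ≤ S.schemeNDT r x) (π : S.Policy μ) :
    g μ ≤ 3 / 2 * π.ndt r := by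
  obtain ⟨H, hH⟩ := S.exists_admissible
  -- `KR ≤ N` permits distinct requests, as the counting bounds require.
  have hd : Function.Injective (Fin.castLE hN) := Fin.castLE_injective hN
  set D := π.delivery (Fin.castLE hN) (fun _ => H) (fun _ => hH) with hD
  have hndt : D.ndt r ≤ π.ndt r :=
    le_iSup_of_le (Fin.castLE hN) (le_iSup_of_le (fun _ => H) (le_iSup_of_le (fun _ => hH) le_rfl))
  refine le_trans ?_ (mul_le_mul_right hndt _)
  have hF := π.F_pos
  have hKT' : (S.KT : ℝ≥0∞) ≠ 0 := by exact_mod_cast (by omega : S.KT ≠ 0)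
  have hKR' : (S.KR : ℝ≥0∞) ≠ 0 := by exact_mod_cast (by omega : S.KR ≠ 0)
  have hF' : (π.F : ℝ≥0∞) ≠ 0 := by exact_mod_cast (by omega : π.F ≠ 0)
  have hKR0 : (0 : ℝ≥0) < S.KR := by exact_mod_cast hKR
  have hF0 : (0 : ℝ≥0) < π.F := by exact_mod_cast hF
  have hne : (Finset.univ : Finset (Fin S.KR × Fin π.F)).Nonempty :=
    ⟨(⟨0, hKR⟩, ⟨0, hF⟩), Finset.mem_univ _⟩
  refine (convex_le_average hKT hKR hnT r hg hgs hne
    (m := fun q => (D.holders (Fin.castLE hN q.1, q.2)).card)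
    (fun q _ => D.one_le_card_holders (fun _ => hH) hd q.1 q.2)
    (fun q _ => by simpa using Finset.card_le_univ (D.holders (Fin.castLE hN q.1, q.2))) μ).trans ?_
  refine mul_le_mul_right ?_ _
  have hcard : (Finset.univ : Finset (Fin S.KR × Fin π.F)).card = S.KR * π.F := by simp
  rw [hcard, Delivery.ndt, add_comm]
  refine add_le_add ?_ ?_
  · have h := D.sum_card_holders_le hd π.cache_le hF
    set A := ∑ q : Fin S.KR × Fin π.F, (D.holders (Fin.castLE hN q.1, q.2)).card
    set W := ∑ i, (D.fronthaul i).card with hW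
    have h1 : (A : ℝ≥0) / (S.KR * π.F : ℕ) - μ * S.KT ≤ (W : ℝ≥0) / (S.KR * π.F : ℕ) := by
      rw [tsub_le_iff_left, Nat.cast_mul, div_le_iff₀ (by positivity), add_mul,
        div_mul_cancel₀ _ (by positivity)]
      refine h.trans_eq ?_
      rw [hW, Nat.cast_sum]
      ring
    refine (mul_le_mul_right (ENNReal.coe_le_coe.2 h1) _).trans
      (le_trans (le_of_eq ?_) (D.sum_card_fronthaul_le hKT r))
    rw [← hW, ENNReal.coe_div (by positivity), deltaF, Nat.cast_one, mul_one]
    push_cast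
    rw [div_eq_mul_inv, div_eq_mul_inv, div_eq_mul_inv,
      ENNReal.mul_inv (Or.inl hKT') (Or.inl (by simp)),
      ENNReal.mul_inv (Or.inl hKR') (Or.inl (by simp)),
      ENNReal.mul_inv (Or.inl hKT') (Or.inl (by simp)),
      ENNReal.mul_inv (Or.inl hF') (Or.inl (by simp))]
    calc _ = ((S.KR : ℝ≥0∞) * (S.KR : ℝ≥0∞)⁻¹) *
          (W * ((S.KT : ℝ≥0∞)⁻¹ * ((π.F : ℝ≥0∞)⁻¹ * (r : ℝ≥0∞)⁻¹))) := by ring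
      _ = _ := by rw [ENNReal.mul_inv_cancel hKR' (by simp), one_mul]
  · have h := D.sum_inv_u_le (fun _ => hH) hd
    simp only [deltaE, div_eq_mul_inv]
    rw [← Finset.mul_sum, Delivery.edgeNDT, Nat.cast_mul,
      ENNReal.mul_inv (Or.inl hKR') (Or.inl (by simp)), div_eq_mul_inv, mul_mul_mul_comm,
      ENNReal.mul_inv_cancel hKR' (by simp), one_mul]
    exact mul_le_mul_left h _

end FRAN

theorem proposition6 (S : FRAN) (hKT : 1 ≤ S.KT) (hKR : 1 ≤ S.KR) (hnT : 1 ≤ S.nT)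
    (hN : S.KR ≤ S.N) (μ r : ℝ≥0) :
    S.deltaAch μ r ≤ 3 / 2 * S.deltaStar μ r := by
  refine iSup₂_le fun g hg => iSup_le fun hgs => ?_
  have h32 : (3 / 2 : ℝ≥0∞) * (3 / 2)⁻¹ = 1 :=
    ENNReal.mul_inv_cancel (by simp) (ENNReal.div_ne_top (by simp) (by simp))
  have hconv : ConvexOn ℝ≥0 Set.univ fun y => (3 / 2 : ℝ≥0∞)⁻¹ * g y := by
    refine ⟨convex_univ, fun x hx y hy a b ha hb hab => ?_⟩
    refine (mul_le_mul_right (hg.2 hx hy ha hb hab) _).trans_eq ?_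
    simp only [ENNReal.smul_def, smul_eq_mul]
    ring
  have hle : ∀ y, (3 / 2 : ℝ≥0∞)⁻¹ * g y ≤ S.deltaBar y r := by
    refine fun y => le_iInf fun π => ?_
    refine (mul_le_mul_right (FRAN.convex_le_ndt hKT hKR hnT hN hg hgs π) _).trans_eq ?_
    rw [← mul_assoc, mul_comm _ (3 / 2 : ℝ≥0∞), h32, one_mul]
  have h : (3 / 2 : ℝ≥0∞)⁻¹ * g μ ≤ S.deltaStar μ r :=
    le_iSup₂_of_le (fun y => (3 / 2 : ℝ≥0∞)⁻¹ * g y) hconv (le_iSup_of_le hle le_rfl)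
  refine le_trans (le_of_eq ?_) (mul_le_mul_right h _)
  rw [← mul_assoc, h32, one_mul]
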